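/- **Theorem (approximation factor of the grid algorithm for minimum-cost domain-restricted $k$-center of polygons).** A *polygon* is a connected compact subset of the plane $\mathbb{R}^2$ whose boundary is a finite union of line segments (not necessarily convex; holes and degenerate polygons, i.e. segments and points, are allowed). Let $P_1,\dots,P_n$ ($n\ge 1$) be pairwise disjoint polygons and let $k\ge 1$. A nonempty set $C\subset\bigcup_i P_i$ with at most $k$ points is a feasible set of centers; its cost is $$\mathrm{cost}(C)=\max_{i}\ \min_{p\in P_i}\ \min_{c\in C} d(c,p),$$ and $\mathrm{OPT}$ is the infimum of $\mathrm{cost}(C)$ over all feasible $C$ (the minimum $k$-center problem). Consider the following algorithm with parameter $\varepsilon>0$. 1. Let $h=\min\bigl(\varepsilon,\ \min_{i\ne j}\min_{u\in P_i,v\in P_j}d(u,v)\bigr)$ and take an axis-parallel square grid of cell length $h$ (with any origin). Let $M_i=P_i\oplus\{x:\|x\|\le h\}$. 2. Let $T_i$ be the set obtained by replacing each grid vertex in $M_i$ by a closest point of a target set $A_i$ (ties broken arbitrarily), and give the points of $T_i$ color $i$. The target set is either (a) $A_i=\bigcup_j P_j$ for all $i$, or (b) $A_i=P_i$ for all $i$.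 3. Return an $\alpha$-approximate solution $C$ of the colorful $k$-center problem on the colored points, where at least one point of every color has to be covered: $C\subset\bigcup_i T_i$ is nonempty, $|C|\le k$, and whenever some nonempty $C'\subset\bigcup_i T_i$ with $|C'|\le k$ has within distance $r$ at least one point of every color, $C$ has within distance $\alpha r$ at least one point of every color. For every $\alpha\ge 1$ there is a constant $K\ge 1$, depending only on $\alpha$ (not on $n$, $k$, $\varepsilon$ or the polygons), such that in both variants the algorithm has an output, and - in variant (a), if $k<n$, every output $C$ is a feasible set of centers with $\mathrm{cost}(C)\le K\cdot\mathrm{OPT}$; - in variant (b), for every $k\ge1$, every output $C$ is a feasible set of centers with $\mathrm{cost}(C)\le K\cdot\mathrm{OPT}$. In particular, with an $O(1)$-approximation for colorful $k$-center (for a constant number of polygons), the algorithm is an $O(1)$-approximation for minimum $k$-center. -/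

import Mathlib

open scoped Pointwise

/-- The Euclidean plane. -/
abbrev Plane : Type := EuclideanSpace ℝ (Fin 2)

/-- A (closed, filled) polygon: a connected compact set whose boundary consists of finitely many
line segments. It may be non-convex, may have holes, and may be degenerate (a segment, a point). -/
def IsPolygon (Q : Set Plane) : Prop :=
  IsConnected Q ∧ IsCompact Q ∧
    ∃ E : Finset (Plane × Plane), frontier Q = ⋃ e ∈ E, segment ℝ e.1 e.2

/-! ### Minimum-cost domain-restricted `k`-center -/

/-- `C` is a nonempty set of at most `k` centers lying in the union of the polygons. -/
def IsFeasible {n : ℕ} (P : Fin n → Set Plane) (k : ℕ) (C : Finset Plane) : Prop :=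
  (C : Set Plane) ⊆ ⋃ i, P i ∧ C.Nonempty ∧ C.card ≤ k

/-- The minimum cost of a set of centers: `max_i min_{p ∈ P i} min_{c ∈ C} d(c, p)`. -/
noncomputable def minCost {n : ℕ} (P : Fin n → Set Plane) (C : Finset Plane) : ℝ :=
  ⨆ i : Fin n, ⨅ p : P i, ⨅ c : C, dist (c : Plane) (p : Plane)

/-- The optimal value of the minimum `k`-center problem on the polygons `P`. -/
noncomputable def optCost {n : ℕ} (P : Fin n → Set Plane) (k : ℕ) : ℝ :=
  sInf (minCost P '' {C | IsFeasible P k C})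

/-! ### Colorful `k`-center on finite colored point sets -/

/-- The balls of radius `r` around the centers `C` cover at least `m i` points of every color `i`,
where `T i` is the set of points of color `i`. -/
def ColorfulCovers {n : ℕ} (T : Fin n → Finset Plane) (m : Fin n → ℕ)
    (C : Finset Plane) (r : ℝ) : Prop :=
  ∀ i, ∃ S ⊆ T i, m i ≤ S.card ∧ ∀ t ∈ S, ∃ c ∈ C, dist t c ≤ r

/-- `C` is a nonempty set of at most `k` centers chosen among the colored points. -/
def IsColorfulCenters {n : ℕ} (T : Fin n → Finset Plane) (k : ℕ) (C : Finset Plane) : Prop :=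
  (∀ c ∈ C, ∃ i, c ∈ T i) ∧ C.Nonempty ∧ C.card ≤ k

/-- `C` is an `α`-approximate solution of the colorful `k`-center instance with color classes `T`
and covering requirements `m`: its covering radius is at most `α` times that of any solution. -/
def IsColorfulApprox {n : ℕ} (α : ℝ) (T : Fin n → Finset Plane) (m : Fin n → ℕ) (k : ℕ)
    (C : Finset Plane) : Prop :=
  IsColorfulCenters T k C ∧
    ∀ (C' : Finset Plane) (r : ℝ), IsColorfulCenters T k C' → ColorfulCovers T m C' r →
      ColorfulCovers T m C (α * r)

/-! ### The algorithm -/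

/-- The resolution `min (ε, min_{i ≠ j} min_{u ∈ P i, v ∈ P j} d(u, v))`. -/
noncomputable def gridStep {n : ℕ} (P : Fin n → Set Plane) (ε : ℝ) : ℝ :=
  sInf (insert ε {d | ∃ i j, i ≠ j ∧ ∃ u ∈ P i, ∃ v ∈ P j, d = dist u v})

/-- The vertices of the axis-parallel square grid of cell length `h` through the point `o`. -/
def gridVertices (o : Plane) (h : ℝ) : Set Plane :=
  {v | ∃ a : Fin 2 → ℤ, ∀ j, v j = o j + a j * h}

/-- `p` is a closest point of `A` to `v`. -/
def IsClosestPoint (A : Set Plane) (v p : Plane) : Prop :=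
  p ∈ A ∧ ∀ q ∈ A, dist v p ≤ dist v q

/-- `T` is a possible result of the sampling phase: with `h` the resolution and
`M i = P i ⊕ (disk of radius h)`, the points `T i` of color `i` are closest points of `A i`
(ties broken arbitrarily) to the vertices of some grid of cell length `h` inside `M i`. -/
def IsSampling {n : ℕ} (P A : Fin n → Set Plane) (ε : ℝ) (T : Fin n → Finset Plane) : Prop :=
  ∃ (o : Plane) (near : Fin n → Plane → Plane),
    (∀ i v, IsClosestPoint (A i) v (near i v)) ∧
    ∀ i, (T i : Set Plane) = near i ''
      (gridVertices o (gridStep P ε) ∩ (P i + Metric.closedBall (0 : Plane) (gridStep P ε)))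

/-- `C` is a possible output of the algorithm on the polygons `P`, the number `k` and the
parameter `ε`, when samples of color `i` are snapped to `A i` and the colorful `k`-center
subroutine returns an `α`-approximate solution (one point of every color has to be covered). -/
def IsOutput {n : ℕ} (P A : Fin n → Set Plane) (α ε : ℝ) (k : ℕ) (C : Finset Plane) : Prop :=
  ∃ T : Fin n → Finset Plane, IsSampling P A ε T ∧ IsColorfulApprox α T (fun _ => 1) k C

section Cost

variable {n : ℕ} {P : Fin n → Set Plane}

theorem minCost_le (hn : 0 < n) {C : Finset Plane} {r : ℝ}
    (h : ∀ i, ∃ p ∈ P i, ∃ c ∈ C, dist c p ≤ r) : minCost P C ≤ r := by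
  have : Nonempty (Fin n) := ⟨⟨0, hn⟩⟩
  refine ciSup_le fun i => ?_
  obtain ⟨p, hp, c, hc, hcp⟩ := h i
  refine ciInf_le_of_le ⟨0, ?_⟩ (⟨p, hp⟩ : P i) (ciInf_le_of_le ⟨0, ?_⟩ (⟨c, hc⟩ : C) hcp)
  · rintro _ ⟨q, rfl⟩
    exact Real.iInf_nonneg fun c => dist_nonneg
  · rintro _ ⟨q, rfl⟩
    exact dist_nonneg

theorem iInf_le_minCost (C : Finset Plane) (i : Fin n) :
    ⨅ p : P i, ⨅ c : C, dist (c : Plane) (p : Plane) ≤ minCost P C :=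
  le_ciSup (f := fun i => ⨅ p : P i, ⨅ c : C, dist (c : Plane) (p : Plane))
    (Set.finite_range _).bddAbove i

theorem exists_dist_lt_of_minCost_lt (hP : ∀ i, (P i).Nonempty) {C : Finset Plane}
    (hC : C.Nonempty) {r : ℝ} (h : minCost P C < r) (i : Fin n) :
    ∃ p ∈ P i, ∃ c ∈ C, dist c p < r := by
  have : Nonempty (P i) := (hP i).to_subtype
  have : Nonempty C := hC.to_subtype
  obtain ⟨p, hp⟩ := exists_lt_of_ciInf_lt ((iInf_le_minCost C i).trans_lt h)
  obtain ⟨c, hc⟩ := exists_lt_of_ciInf_lt hp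
  exact ⟨p, p.2, c, c.2, hc⟩

theorem minCost_nonneg (C : Finset Plane) : 0 ≤ minCost P C :=
  Real.iSup_nonneg fun _ => Real.iInf_nonneg fun _ => Real.iInf_nonneg fun _ => dist_nonneg

theorem optCost_nonneg (k : ℕ) : 0 ≤ optCost P k := by
  refine Real.sInf_nonneg ?_
  rintro _ ⟨C, -, rfl⟩
  exact minCost_nonneg C

theorem exists_isFeasible (hn : 0 < n) (hP : ∀ i, (P i).Nonempty) {k : ℕ} (hk : 0 < k) :
    ∃ C, IsFeasible P k C := by
  obtain ⟨p, hp⟩ := hP ⟨0, hn⟩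
  refine ⟨{p}, ?_, Finset.singleton_nonempty p, by simpa using Nat.succ_le_of_lt hk⟩
  simpa using ⟨_, hp⟩

/-- With fewer centers than polygons, some polygon contains no center. -/
theorem exists_forall_notMem {k : ℕ} (hkn : k < n) (hd : ∀ i j, i ≠ j → Disjoint (P i) (P j))
    {C : Finset Plane} (hC : C.card ≤ k) : ∃ i, ∀ c ∈ C, c ∉ P i := by
  by_contra! H
  choose f hfC hfP using H
  have hinj : Function.Injective f := by
    intro i j hij
    by_contra hne
    exact Set.disjoint_left.1 (hd i j hne) (hfP i) (hij ▸ hfP j)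
  have := Finset.card_le_card_of_injOn (s := Finset.univ) (t := C) f (fun i _ => hfC i)
    hinj.injOn
  simp at this
  omega

theorem le_optCost (hn : 0 < n) (hP : ∀ i, (P i).Nonempty) {k : ℕ} (hk : 0 < k) (hkn : k < n)
    (hd : ∀ i j, i ≠ j → Disjoint (P i) (P j)) {h : ℝ}
    (hh : ∀ i j, i ≠ j → ∀ u ∈ P i, ∀ v ∈ P j, h ≤ dist u v) : h ≤ optCost P k := by
  obtain ⟨C₀, hC₀⟩ := exists_isFeasible hn hP hk
  refine le_csInf ⟨_, C₀, hC₀, rfl⟩ ?_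
  rintro _ ⟨C, ⟨hCP, hCne, hCk⟩, rfl⟩
  obtain ⟨i, hi⟩ := exists_forall_notMem hkn hd hCk
  have : Nonempty (P i) := (hP i).to_subtype
  have : Nonempty C := hCne.to_subtype
  refine le_trans (le_ciInf fun p => le_ciInf fun c => ?_) (iInf_le_minCost C i)
  obtain ⟨j, hj⟩ := Set.mem_iUnion.1 (hCP c.2)
  exact hh j i (fun e => hi c c.2 (e ▸ hj)) c hj p p.2

end Cost

section Grid

variable {n : ℕ} {P : Fin n → Set Plane} {ε : ℝ}

theorem bddBelow_gridStep_set (P : Fin n → Set Plane) (hε : 0 < ε) :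
    BddBelow (insert ε {d | ∃ i j, i ≠ j ∧ ∃ u ∈ P i, ∃ v ∈ P j, d = dist u v}) := by
  refine ⟨0, ?_⟩
  rintro _ (rfl | ⟨i, j, -, u, -, v, -, rfl⟩)
  · exact hε.le
  · exact dist_nonneg

theorem gridStep_le_dist (hε : 0 < ε) {i j : Fin n} (hij : i ≠ j) {u v : Plane} (hu : u ∈ P i)
    (hv : v ∈ P j) : gridStep P ε ≤ dist u v :=
  csInf_le (bddBelow_gridStep_set P hε) (Or.inr ⟨i, j, hij, u, hu, v, hv, rfl⟩)

theorem gridStep_pos (hε : 0 < ε) (hP : ∀ i, IsCompact (P i))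
    (hd : ∀ i j, i ≠ j → Disjoint (P i) (P j)) : 0 < gridStep P ε := by
  have key : ∀ᶠ δ : ℝ in nhdsWithin 0 (Set.Ioi 0), ∀ i j : Fin n, i ≠ j → ∀ u ∈ P i, ∀ v ∈ P j,
      δ ≤ dist u v := by
    refine Filter.eventually_all.2 fun i => Filter.eventually_all.2 fun j => ?_
    by_cases hij : i = j
    · simp [hij]
    obtain ⟨r, hr, H⟩ := Metric.exists_pos_forall_lt_edist (hP i) (hP j).isClosed (hd i j hij)
    filter_upwards [Ioo_mem_nhdsGT (NNReal.coe_pos.2 hr)] with δ hδ _ u hu v hv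
    have := H u hu v hv
    rw [edist_nndist, ENNReal.coe_lt_coe, ← NNReal.coe_lt_coe, coe_nndist] at this
    exact (hδ.2.trans this).le
  obtain ⟨δ, hδ, hδ0, hδε⟩ := (key.and (Ioo_mem_nhdsGT hε)).exists
  refine hδ0.trans_le (le_csInf (Set.insert_nonempty _ _) ?_)
  rintro _ (rfl | ⟨i, j, hij, u, hu, v, hv, rfl⟩)
  · exact hδε.le
  · exact hδ i j hij u hu v hv

theorem exists_gridVertices_dist_le (o : Plane) {h : ℝ} (hh : 0 < h) (p : Plane) :
    ∃ v ∈ gridVertices o h, dist v p ≤ 3 / 4 * h := by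
  refine ⟨WithLp.toLp 2 fun j => o j + (round ((p j - o j) / h) : ℤ) * h,
    ⟨fun j => round ((p j - o j) / h), fun j => rfl⟩, ?_⟩
  have hj : ∀ j, |o j + (round ((p j - o j) / h) : ℤ) * h - p j| ≤ h / 2 := by
    intro j
    have h1 := abs_sub_round ((p j - o j) / h)
    have h2 : o j + (round ((p j - o j) / h) : ℤ) * h - p j
        = -(((p j - o j) / h - (round ((p j - o j) / h) : ℤ)) * h) := by
      field_simp
      ring
    rw [h2, abs_neg, abs_mul, abs_of_pos hh]
    nlinarith
  rw [EuclideanSpace.dist_eq, Fin.sum_univ_two]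
  refine Real.sqrt_le_iff.2 ⟨by positivity, ?_⟩
  have h0 := sq_le_sq' (abs_le.1 (hj 0)).1 (abs_le.1 (hj 0)).2
  have h1 := sq_le_sq' (abs_le.1 (hj 1)).1 (abs_le.1 (hj 1)).2
  simp only [Real.dist_eq, sq_abs]
  nlinarith

theorem finite_gridVertices_inter (o : Plane) {h : ℝ} (hh : 0 < h) {B : Set Plane}
    (hB : Bornology.IsBounded B) : (gridVertices o h ∩ B).Finite := by
  obtain ⟨R, hR⟩ := hB.exists_norm_le
  refine ((Set.finite_Icc (fun j => ⌈(-R - o j) / h⌉ : Fin 2 → ℤ)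
    (fun j => ⌊(R - o j) / h⌋)).image
      fun a => (WithLp.toLp 2 fun j => o j + a j * h : Plane)).subset ?_
  rintro v ⟨⟨a, ha⟩, hv⟩
  have hb : ∀ j, |o j + a j * h| ≤ R := fun j => by
    rw [← ha j, ← Real.norm_eq_abs]
    exact (PiLp.norm_apply_le v j).trans (hR v hv)
  refine ⟨a, ⟨fun j => ?_, fun j => ?_⟩, ?_⟩
  · rw [Int.ceil_le, div_le_iff₀ hh]
    linarith [(abs_le.1 (hb j)).1]
  · rw [Int.le_floor, le_div_iff₀ hh]
    linarith [(abs_le.1 (hb j)).2]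
  · ext j
    exact (ha j).symm

theorem IsCompact.exists_isClosestPoint {A : Set Plane} (hA : IsCompact A) (hne : A.Nonempty)
    (v : Plane) : ∃ p, IsClosestPoint A v p := by
  obtain ⟨p, hp, h⟩ := hA.exists_isMinOn hne (f := fun q => dist v q) (by fun_prop)
  exact ⟨p, hp, fun q hq => h hq⟩

end Grid

section Sampling

variable {n : ℕ} {P A : Fin n → Set Plane} {ε : ℝ} {T : Fin n → Finset Plane}

theorem exists_isSampling (hh : 0 < gridStep P ε) (hP : ∀ i, IsCompact (P i))
    (hA : ∀ i, IsCompact (A i)) (hne : ∀ i, (A i).Nonempty) : ∃ T, IsSampling P A ε T := by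
  choose near hnear using fun i v => (hA i).exists_isClosestPoint (hne i) v
  have hfin : ∀ i, (near i '' (gridVertices 0 (gridStep P ε) ∩
      (P i + Metric.closedBall (0 : Plane) (gridStep P ε)))).Finite := fun i =>
    (finite_gridVertices_inter 0 hh
      ((hP i).isBounded.add Metric.isBounded_closedBall)).image _
  exact ⟨fun i => (hfin i).toFinset, 0, near, hnear, fun i => (hfin i).coe_toFinset⟩

theorem IsSampling.mem_target (hT : IsSampling P A ε T) {i : Fin n} {t : Plane} (ht : t ∈ T i) :
    t ∈ A i := by
  obtain ⟨o, near, hnear, hT⟩ := hT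
  rw [← Finset.mem_coe, hT i] at ht
  obtain ⟨v, -, rfl⟩ := ht
  exact (hnear i v).1

/-- Every point of a polygon is close to a sample of its color. -/
theorem IsSampling.exists_sample (hT : IsSampling P A ε T) (hh : 0 < gridStep P ε)
    (hPA : ∀ i, P i ⊆ A i) {i : Fin n} {p : Plane} (hp : p ∈ P i) :
    ∃ t ∈ T i, dist t p ≤ 3 / 2 * gridStep P ε := by
  obtain ⟨o, near, hnear, hT⟩ := hT
  obtain ⟨v, hv, hvp⟩ := exists_gridVertices_dist_le o hh p
  refine ⟨near i v, ?_, ?_⟩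
  · rw [← Finset.mem_coe, hT i]
    refine ⟨v, ⟨hv, p, hp, v - p, ?_, add_sub_cancel _ _⟩, rfl⟩
    rw [mem_closedBall_zero_iff, ← dist_eq_norm]
    linarith
  · have h1 := (hnear i v).2 p (hPA i hp)
    have h2 := dist_triangle_left (near i v) p v
    linarith

/-- Every sample is close to the polygon of its color. -/
theorem IsSampling.exists_polygon_point (hT : IsSampling P A ε T) (hPA : ∀ i, P i ⊆ A i)
    {i : Fin n} {t : Plane} (ht : t ∈ T i) : ∃ p ∈ P i, dist t p ≤ 2 * gridStep P ε := by
  obtain ⟨o, near, hnear, hT⟩ := hT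
  rw [← Finset.mem_coe, hT i] at ht
  obtain ⟨_, ⟨-, p, hp, b, hb, rfl⟩, rfl⟩ := ht
  refine ⟨p, hp, ?_⟩
  have h1 := (hnear i (p + b)).2 p (hPA i hp)
  have h2 := dist_triangle_left (near i (p + b)) p (p + b)
  have h3 : dist (p + b) p ≤ gridStep P ε := by
    rw [dist_eq_norm, add_sub_cancel_left]
    exact mem_closedBall_zero_iff.1 hb
  simp only at h1 h2 ⊢
  linarith

end Sampling

section Colorful

variable {n : ℕ} {T : Fin n → Finset Plane} {C : Finset Plane} {r : ℝ}

theorem colorfulCovers_one_iff :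
    ColorfulCovers T (fun _ => 1) C r ↔ ∀ i, ∃ t ∈ T i, ∃ c ∈ C, dist t c ≤ r := by
  refine forall_congr' fun i => ⟨?_, ?_⟩
  · rintro ⟨S, hS, hcard, h⟩
    obtain ⟨t, ht⟩ := Finset.card_pos.1 hcard
    exact ⟨t, hS ht, h t ht⟩
  · rintro ⟨t, ht, h⟩
    exact ⟨{t}, by simpa using ht, by simp, by simpa using h⟩

theorem exists_least_colorfulCovers (hn : 0 < n) (hT : ∀ i, (T i).Nonempty) (hC : C.Nonempty) :
    ∃ ρ, ∀ r, ColorfulCovers T (fun _ => 1) C r ↔ ρ ≤ r := by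
  have : Nonempty (Fin n) := ⟨⟨0, hn⟩⟩
  have hmin : ∀ i, ∃ x ∈ T i ×ˢ C, ∀ y ∈ T i ×ˢ C, dist x.1 x.2 ≤ dist y.1 y.2 := fun i =>
    Finset.exists_min_image _ (fun x : Plane × Plane => dist x.1 x.2) ((hT i).product hC)
  choose x hx hxmin using hmin
  obtain ⟨i₀, hi₀⟩ := Finite.exists_max fun i => dist (x i).1 (x i).2
  refine ⟨dist (x i₀).1 (x i₀).2, fun r => colorfulCovers_one_iff.trans ⟨fun h => ?_, fun h i => ?_⟩⟩
  · obtain ⟨t, ht, c, hc, hr⟩ := h i₀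
    exact (hxmin i₀ (t, c) (Finset.mk_mem_product ht hc)).trans hr
  · obtain ⟨h1, h2⟩ := Finset.mem_product.1 (hx i)
    exact ⟨_, h1, _, h2, (hi₀ i).trans h⟩

theorem exists_isColorfulApprox (hn : 0 < n) {k : ℕ} (hk : 0 < k) (hT : ∀ i, (T i).Nonempty)
    {α : ℝ} (hα : 1 ≤ α) : ∃ C, IsColorfulApprox α T (fun _ => 1) k C := by
  classical
  have hfin : {C : Finset Plane | IsColorfulCenters T k C}.Finite := by
    refine (Finset.finite_toSet (Finset.univ.biUnion T).powerset).subset fun C hC => ?_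
    simp only [Finset.mem_coe, Finset.mem_powerset]
    intro c hc
    simpa using hC.1 c hc
  have hne : {C : Finset Plane | IsColorfulCenters T k C}.Nonempty := by
    obtain ⟨t, ht⟩ := hT ⟨0, hn⟩
    exact ⟨{t}, by simpa using ⟨_, ht⟩, Finset.singleton_nonempty t, by simpa using Nat.succ_le_of_lt hk⟩
  have hρ : ∀ C : Finset Plane, ∃ ρ, C.Nonempty →
      ∀ r, ColorfulCovers T (fun _ => 1) C r ↔ ρ ≤ r := fun C => by
    by_cases hC : C.Nonempty
    · exact (exists_least_colorfulCovers hn hT hC).imp fun _ h _ => h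
    · exact ⟨0, fun h => absurd h hC⟩
  choose ρ hρ using hρ
  obtain ⟨C, hC, hmin⟩ := Set.exists_min_image _ ρ hfin hne
  refine ⟨C, hC, fun C' r hC' hcov => ?_⟩
  have hr : 0 ≤ r := by
    obtain ⟨t, -, c, -, h⟩ := colorfulCovers_one_iff.1 hcov ⟨0, hn⟩
    exact dist_nonneg.trans h
  have h1 := (hρ C' hC'.2.1 r).1 hcov
  refine (hρ C hC.2.1 _).2 ((hmin C' hC').trans (h1.trans ?_))
  exact le_mul_of_one_le_left hr hα

end Colorful

section Output

variable {n k : ℕ} {P A : Fin n → Set Plane} {α ε : ℝ} {T : Fin n → Finset Plane}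
  {C : Finset Plane}

theorem exists_isOutput (hn : 0 < n) (hk : 0 < k) (hα : 1 ≤ α) (hh : 0 < gridStep P ε)
    (hP : ∀ i, IsCompact (P i)) (hne : ∀ i, (P i).Nonempty) (hA : ∀ i, IsCompact (A i))
    (hPA : ∀ i, P i ⊆ A i) : ∃ C, IsOutput P A α ε k C := by
  obtain ⟨T, hT⟩ := exists_isSampling hh hP hA fun i => (hne i).mono (hPA i)
  have hTne : ∀ i, (T i).Nonempty := fun i => by
    obtain ⟨p, hp⟩ := hne i
    obtain ⟨t, ht, -⟩ := hT.exists_sample hh hPA hp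
    exact ⟨t, ht⟩
  obtain ⟨C, hC⟩ := exists_isColorfulApprox hn hk hTne hα
  exact ⟨C, T, hT, hC⟩

theorem IsOutput.isFeasible (hAP : ∀ i, A i ⊆ ⋃ j, P j) (hC : IsOutput P A α ε k C) :
    IsFeasible P k C := by
  obtain ⟨T, hT, hC, -⟩ := hC
  refine ⟨fun c hc => ?_, hC.2⟩
  obtain ⟨i, hi⟩ := hC.1 c hc
  exact hAP i (hT.mem_target hi)

/-- Snapping the centers of a feasible solution to samples increases the covering radius by at
most three grid steps. -/
theorem IsSampling.exists_isColorfulCenters (hT : IsSampling P A ε T) (hh : 0 < gridStep P ε)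
    (hPA : ∀ i, P i ⊆ A i) (hC : IsFeasible P k C) {r : ℝ}
    (hr : ∀ i, ∃ p ∈ P i, ∃ c ∈ C, dist c p ≤ r) :
    ∃ C', IsColorfulCenters T k C' ∧
      ColorfulCovers T (fun _ => 1) C' (r + 3 * gridStep P ε) := by
  classical
  have hsnap : ∀ c : Plane, ∃ t, c ∈ C → (∃ i, t ∈ T i) ∧ dist t c ≤ 3 / 2 * gridStep P ε := by
    intro c
    by_cases hc : c ∈ C
    · obtain ⟨i, hi⟩ := Set.mem_iUnion.1 (hC.1 hc)
      obtain ⟨t, ht, htc⟩ := hT.exists_sample hh hPA hi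
      exact ⟨t, fun _ => ⟨⟨i, ht⟩, htc⟩⟩
    · exact ⟨c, fun h => absurd h hc⟩
  choose s hs using hsnap
  refine ⟨C.image s, ⟨?_, hC.2.1.image s, Finset.card_image_le.trans hC.2.2⟩,
    colorfulCovers_one_iff.2 fun i => ?_⟩
  · intro t ht
    obtain ⟨c, hc, rfl⟩ := Finset.mem_image.1 ht
    exact (hs c hc).1
  · obtain ⟨p, hp, c, hc, hcp⟩ := hr i
    obtain ⟨t, ht, htp⟩ := hT.exists_sample hh hPA hp
    refine ⟨t, ht, s c, Finset.mem_image_of_mem s hc, ?_⟩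
    have h1 := (hs c hc).2
    have h2 := dist_triangle4 t p c (s c)
    rw [dist_comm p c, dist_comm c (s c)] at h2
    linarith

theorem IsOutput.minCost_le_add (hn : 0 < n) (hk : 0 < k) (hα : 1 ≤ α) (hh : 0 < gridStep P ε)
    (hne : ∀ i, (P i).Nonempty) (hPA : ∀ i, P i ⊆ A i) (hC : IsOutput P A α ε k C) :
    minCost P C ≤ α * (optCost P k + 3 * gridStep P ε) + 2 * gridStep P ε := by
  obtain ⟨T, hT, -, happrox⟩ := hC
  refine le_of_forall_pos_le_add fun η hη => ?_
  have hα0 : 0 < α := by linarith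
  obtain ⟨C₀, hC₀⟩ := exists_isFeasible hn hne hk
  obtain ⟨_, ⟨C₁, hC₁, rfl⟩, hlt⟩ := exists_lt_of_csInf_lt
    (s := minCost P '' {C | IsFeasible P k C}) ⟨_, C₀, hC₀, rfl⟩
    (show optCost P k < optCost P k + η / α by linarith [div_pos hη hα0])
  obtain ⟨C', hC', hcov⟩ := hT.exists_isColorfulCenters hh hPA hC₁ fun i => by
    obtain ⟨p, hp, c, hc, h⟩ := exists_dist_lt_of_minCost_lt hne hC₁.2.1 hlt i
    exact ⟨p, hp, c, hc, h.le⟩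
  have hout := colorfulCovers_one_iff.1 (happrox C' _ hC' hcov)
  refine minCost_le hn fun i => ?_
  obtain ⟨t, ht, c, hc, htc⟩ := hout i
  obtain ⟨p, hp, htp⟩ := hT.exists_polygon_point hPA ht
  refine ⟨p, hp, c, hc, ?_⟩
  have h1 := dist_triangle_left c p t
  have h2 : α * (optCost P k + η / α + 3 * gridStep P ε)
      = α * (optCost P k + 3 * gridStep P ε) + η := by
    field_simp
    ring
  linarith

/-- If there are at least as many centers as polygons and samples are taken inside the polygons,
then the output has cost zero. -/
theorem IsOutput.minCost_le_zero (hn : 0 < n) (hnk : n ≤ k) (hh : 0 < gridStep P ε)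
    (hne : ∀ i, (P i).Nonempty) (hC : IsOutput P P α ε k C) : minCost P C ≤ 0 := by
  classical
  obtain ⟨T, hT, -, happrox⟩ := hC
  have hTne : ∀ i, ∃ t, t ∈ T i := fun i => by
    obtain ⟨p, hp⟩ := hne i
    obtain ⟨t, ht, -⟩ := hT.exists_sample hh (fun _ => subset_rfl) hp
    exact ⟨t, ht⟩
  choose t ht using hTne
  have hC' : IsColorfulCenters T k (Finset.univ.image t) := by
    refine ⟨?_, ⟨t ⟨0, hn⟩, by simp⟩, Finset.card_image_le.trans (by simpa using hnk)⟩
    intro c hc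
    obtain ⟨i, -, rfl⟩ := Finset.mem_image.1 hc
    exact ⟨i, ht i⟩
  have hcov : ColorfulCovers T (fun _ => 1) (Finset.univ.image t) 0 :=
    colorfulCovers_one_iff.2 fun i => ⟨t i, ht i, t i, by simp, by simp⟩
  have hout := colorfulCovers_one_iff.1 (happrox _ _ hC' hcov)
  refine minCost_le hn fun i => ?_
  obtain ⟨u, hu, c, hc, huc⟩ := hout i
  exact ⟨u, hT.mem_target hu, c, hc, by rwa [dist_comm, ← mul_zero α]⟩

theorem IsOutput.minCost_le_mul (hn : 0 < n) (hk : 0 < k) (hkn : k < n) (hα : 1 ≤ α)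
    (hε : 0 < ε) (hh : 0 < gridStep P ε) (hne : ∀ i, (P i).Nonempty)
    (hd : ∀ i j, i ≠ j → Disjoint (P i) (P j)) (hPA : ∀ i, P i ⊆ A i)
    (hC : IsOutput P A α ε k C) : minCost P C ≤ (4 * α + 2) * optCost P k := by
  have h1 := hC.minCost_le_add hn hk hα hh hne hPA
  have h2 : gridStep P ε ≤ optCost P k := le_optCost hn hne hk hkn hd
    fun i j hij u hu v hv => gridStep_le_dist hε hij hu hv
  have h3 := mul_le_mul_of_nonneg_left h2 (show 0 ≤ α by linarith)
  linarith

end Output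

theorem mainTheorem11 (α : ℝ) (hα : 1 ≤ α) :
    ∃ K : ℝ, 1 ≤ K ∧
      ∀ (n k : ℕ) (P : Fin n → Set Plane) (ε : ℝ), 0 < n → 0 < k → 0 < ε →
        (∀ i, IsPolygon (P i)) → (∀ i j, i ≠ j → Disjoint (P i) (P j)) →
        -- samples are snapped to the union of all polygons
        ((∃ C, IsOutput P (fun _ => ⋃ j, P j) α ε k C) ∧
          (k < n → ∀ C, IsOutput P (fun _ => ⋃ j, P j) α ε k C →
            IsFeasible P k C ∧ minCost P C ≤ K * optCost P k)) ∧
        -- samples of the i-th color are snapped to the i-th polygon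
        ((∃ C, IsOutput P P α ε k C) ∧
          ∀ C, IsOutput P P α ε k C →
            IsFeasible P k C ∧ minCost P C ≤ K * optCost P k) := by
  refine ⟨4 * α + 2, by linarith, fun n k P ε hn hk hε hP hd => ?_⟩
  have hcpt : ∀ i, IsCompact (P i) := fun i => (hP i).2.1
  have hne : ∀ i, (P i).Nonempty := fun i => (hP i).1.nonempty
  have hh : 0 < gridStep P ε := gridStep_pos hε hcpt hd
  have hsub : ∀ i, P i ⊆ ⋃ j, P j := Set.subset_iUnion P
  refine ⟨⟨exists_isOutput hn hk hα hh hcpt hne (fun _ => isCompact_iUnion hcpt) hsub,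
    fun hkn C hC => ⟨hC.isFeasible fun _ => subset_rfl,
      hC.minCost_le_mul hn hk hkn hα hε hh hne hd hsub⟩⟩,
    exists_isOutput hn hk hα hh hcpt hne hcpt fun _ => subset_rfl,
    fun C hC => ⟨hC.isFeasible hsub, ?_⟩⟩
  rcases lt_or_ge k n with hkn | hnk
  · exact hC.minCost_le_mul hn hk hkn hα hε hh hne hd fun _ => subset_rfl
  · exact (hC.minCost_le_zero hn hnk hh hne).trans
      (mul_nonneg (by linarith) (optCost_nonneg k))
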